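/- Let $A$ be an associative unital ring and let $\mathsf{Mod}\,A$ be the category of left $A$-modules. A localizing subcategory of $\mathsf{Mod}\,A$ is a class $\mathsf{N}$ of modules closed under submodules, quotients, extensions and arbitrary direct sums (in particular it contains $0$); its torsion functor is $\Gamma_{\mathsf N} M = \{ m \in M \mid A\cdot m \in \mathsf N\}$. Let $\mathsf{M} = \{\mathsf{M}_q\}_{q\in\mathbb Z}$ be an increasing filtration of $\mathsf{Mod}\,A$ by localizing subcategories which is bounded, i.e. there are integers $q_0 \le q_1$ with $\mathsf M_{q_0-1} = 0$ and $\mathsf M_{q_1} = \mathsf{Mod}\,A$; write $\mathsf M^p := \mathsf M_{-p}$, a decreasing filtration. For $p \le p'$ put $\Gamma_{\mathsf M^p/\mathsf M^{p'}} M := \Gamma_{\mathsf M^p} M / \Gamma_{\mathsf M^{p'}} M$, let $\mathrm R\Gamma_{\mathsf M^p/\mathsf M^{p'}}$ be its right derived functor on $\mathsf D^+(\mathsf{Mod}\,A)$, and let $\mathrm H^n_{\mathsf M^p/\mathsf M^{p'}} := \mathrm H^n \mathrm R\Gamma_{\mathsf M^p/\mathsf M^{p'}}$. For $M \in \mathsf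 D^+(\mathsf{Mod}\,A)$ with bounded below injective resolution $M \to I$, the filtered complex $\{\Gamma_{\mathsf M^p} I\}_p$ gives a spectral sequence with $E_1^{p,q} = \mathrm H^{p+q}_{\mathsf M^p/\mathsf M^{p+1}} M$. The Cousin complex $\mathrm E_{\mathsf M} M$ is the row $q=0$ of its first page: $(\mathrm E_{\mathsf M} M)^p = \mathrm H^p_{\mathsf M^p/\mathsf M^{p+1}} M$, with coboundary $d_1^{p,0}$, the composite of the connecting homomorphism $\mathrm H^p_{\mathsf M^p/\mathsf M^{p+1}} M \to \mathrm H^{p+1}(\Gamma_{\mathsf M^{p+1}} I)$ and the canonical map $\mathrm H^{p+1}(\Gamma_{\mathsf M^{p+1}} I) \to \mathrm H^{p+1}_{\mathsf M^{p+1}/\mathsf M^{p+2}} M$. Let $\mathrm Q$ denote the localization functor from complexes of $A$-modules to the derived category $\mathsf D(\mathsf{Mod}\,A)$. **Theorem.** Let $M \in \mathsf D^{\mathrm b}(\mathsf{Mod}\,A)$ satisfy $\mathrm H^{p+q}_{\mathsf M^p/\mathsf M^{p+1}} M = 0$ for all $q \ne 0$ and all $p$. Then there is an isomorphism $M \cong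 \mathrm Q\,\mathrm E_{\mathsf M} M$ in $\mathsf D(\mathsf{Mod}\,A)$. -/

import Mathlib

open CategoryTheory Limits

universe w u

noncomputable section

namespace Cousin

variable {A : Type u} [Ring A]

/-! ### Localizing subcategories and torsion functors -/

/-- A localizing subcategory (hereditary torsion class) of the category of left `A`-modules:
a class of modules closed under subobjects, quotients, extensions and
arbitrary direct sums. -/
class IsLocalizing (P : ObjectProperty (ModuleCat.{u} A)) : Prop extends P.IsSerreClass where
  isClosedUnderCoproducts (J : Type u) : P.IsClosedUnderColimitsOfShape (Discrete J)

section Torsion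

variable (P Q : ObjectProperty (ModuleCat.{u} A)) [IsLocalizing P] [IsLocalizing Q]

lemma prop_of_le {M : ModuleCat.{u} A} {N N' : Submodule A M} (h : N ≤ N')
    (hN' : P (ModuleCat.of A N')) : P (ModuleCat.of A N) := by
  have : Mono (ModuleCat.ofHom (Submodule.inclusion h)) :=
    (ModuleCat.mono_iff_injective _).2 (Submodule.inclusion_injective h)
  exact P.prop_of_mono (ModuleCat.ofHom (Submodule.inclusion h)) hN'

lemma prop_sup {M : ModuleCat.{u} A} {N N' : Submodule A M}
    (hN : P (ModuleCat.of A N)) (hN' : P (ModuleCat.of A N')) :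
    P (ModuleCat.of A (N ⊔ N' : Submodule A M)) := by
  let f : N →ₗ[A] (N ⊔ N' : Submodule A M) := Submodule.inclusion le_sup_left
  let g : N' →ₗ[A] (N ⊔ N' : Submodule A M) := Submodule.inclusion le_sup_right
  have hfg : Function.Surjective (f.coprod g) := by
    rintro ⟨x, hx⟩
    obtain ⟨y, hy, z, hz, rfl⟩ := Submodule.mem_sup.1 hx
    exact ⟨(⟨y, hy⟩, ⟨z, hz⟩), by ext; simp [f, g]⟩
  have : Epi (ModuleCat.ofHom (f.coprod g)) := (ModuleCat.epi_iff_surjective _).2 hfg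
  have hprod : P (ModuleCat.of A (N × N')) :=
    P.prop_of_iso (ModuleCat.biprodIsoProd (ModuleCat.of A N) (ModuleCat.of A N'))
      (P.prop_biprod hN hN')
  exact P.prop_of_epi (ModuleCat.ofHom (f.coprod g)) hprod

lemma prop_map {M M' : ModuleCat.{u} A} (f : M ⟶ M') {N : Submodule A M}
    (hN : P (ModuleCat.of A N)) : P (ModuleCat.of A (N.map f.hom)) := by
  have : Epi (ModuleCat.ofHom (f.hom.submoduleMap N)) :=
    (ModuleCat.epi_iff_surjective _).2 (f.hom.submoduleMap_surjective N)
  exact P.prop_of_epi (ModuleCat.ofHom (f.hom.submoduleMap N)) hN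

/-- The submodule `Γ_P M = {m ∈ M | A · m ∈ P}` of elements of `M` supported on the localizing
subcategory `P`. -/
def torsion (M : ModuleCat.{u} A) : Submodule A M where
  carrier := {m | P (ModuleCat.of A (Submodule.span A {m}))}
  zero_mem' := P.prop_of_isZero (by
    rw [Submodule.span_zero_singleton]
    exact ModuleCat.isZero_of_subsingleton _)
  add_mem' {x y} hx hy := by
    refine prop_of_le P ?_ (prop_sup P hx hy)
    rw [Submodule.span_singleton_le_iff_mem]
    exact Submodule.add_mem_sup (Submodule.mem_span_singleton_self x)
      (Submodule.mem_span_singleton_self y)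
  smul_mem' a x hx := by
    refine prop_of_le P ?_ hx
    rw [Submodule.span_singleton_le_iff_mem]
    exact Submodule.smul_mem _ a (Submodule.mem_span_singleton_self x)

lemma mem_torsion_iff {M : ModuleCat.{u} A} (m : M) :
    m ∈ torsion P M ↔ P (ModuleCat.of A (Submodule.span A {m})) := Iff.rfl

lemma torsion_le_comap {M N : ModuleCat.{u} A} (f : M ⟶ N) :
    torsion P M ≤ (torsion P N).comap f.hom := by
  intro m hm
  have := prop_map P f hm
  rw [Submodule.map_span, Set.image_singleton] at this
  exact this

variable {P Q} in
lemma torsion_mono (h : P ≤ Q) (M : ModuleCat.{u} A) : torsion P M ≤ torsion Q M :=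
  fun _ hm => h _ hm

/-- The torsion functor `Γ_P : Mod A ⥤ Mod A`. -/
@[simps]
def torsionFunctor : ModuleCat.{u} A ⥤ ModuleCat.{u} A where
  obj M := ModuleCat.of A (torsion P M)
  map f := ModuleCat.ofHom (f.hom.restrict (torsion_le_comap P f))

instance : (torsionFunctor P).Additive where

lemma submoduleOf_le_comap {M N : ModuleCat.{u} A} (f : M ⟶ N) :
    (torsion P M).submoduleOf (torsion Q M) ≤
      ((torsion P N).submoduleOf (torsion Q N)).comap
        (f.hom.restrict (torsion_le_comap Q f)) :=
  fun _ hm => torsion_le_comap P f hm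

/-- The functor `M ↦ Γ_Q M / Γ_P M`, for localizing subcategories `P ⊆ Q`. -/
@[simps]
def torsionQuotient : ModuleCat.{u} A ⥤ ModuleCat.{u} A where
  obj M := ModuleCat.of A (torsion Q M ⧸ (torsion P M).submoduleOf (torsion Q M))
  map f := ModuleCat.ofHom (Submodule.mapQ _ _ (f.hom.restrict (torsion_le_comap Q f))
    (submoduleOf_le_comap P Q f))
  map_id M := by
    ext x
    rfl
  map_comp f g := by
    ext x
    rfl

instance : (torsionQuotient P Q).Additive where
  map_add {M N f g} := by
    ext x
    obtain ⟨x, rfl⟩ := Submodule.Quotient.mk_surjective _ x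
    rfl

variable {P Q} in
/-- The inclusion `Γ_P ⟶ Γ_Q` when `P ⊆ Q`. -/
@[simps]
def torsionInclusion (h : P ≤ Q) : torsionFunctor P ⟶ torsionFunctor Q where
  app M := ModuleCat.ofHom (Submodule.inclusion (torsion_mono h M))

/-- The projection `Γ_Q ⟶ Γ_Q / Γ_P`. -/
@[simps]
def torsionProjection : torsionFunctor Q ⟶ torsionQuotient P Q where
  app M := ModuleCat.ofHom (Submodule.mkQ _)

variable {P Q} in
/-- The sequence `0 ⟶ Γ_P K ⟶ Γ_Q K ⟶ Γ_Q K / Γ_P K ⟶ 0` for a cochain complex `K`. -/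
@[simps]
def torsionSequence (h : P ≤ Q) :
    CochainComplex (ModuleCat.{u} A) ℤ ⥤ ShortComplex (CochainComplex (ModuleCat.{u} A) ℤ) where
  obj K :=
    { X₁ := ((torsionFunctor P).mapHomologicalComplex _).obj K
      X₂ := ((torsionFunctor Q).mapHomologicalComplex _).obj K
      X₃ := ((torsionQuotient P Q).mapHomologicalComplex _).obj K
      f := (NatTrans.mapHomologicalComplex (torsionInclusion h) _).app K
      g := (NatTrans.mapHomologicalComplex (torsionProjection P Q) _).app K
      zero := by
        ext n x
        exact (Submodule.Quotient.mk_eq_zero _).2 x.2 }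
  map φ :=
    { τ₁ := ((torsionFunctor P).mapHomologicalComplex _).map φ
      τ₂ := ((torsionFunctor Q).mapHomologicalComplex _).map φ
      τ₃ := ((torsionQuotient P Q).mapHomologicalComplex _).map φ
      comm₁₂ := ((NatTrans.mapHomologicalComplex (torsionInclusion h) _).naturality φ)
      comm₂₃ := ((NatTrans.mapHomologicalComplex (torsionProjection P Q) _).naturality φ) }

variable {P Q} in
lemma torsionSequence_shortExact (h : P ≤ Q) (K : CochainComplex (ModuleCat.{u} A) ℤ) :
    ((torsionSequence h).obj K).ShortExact := by
  refine HomologicalComplex.shortExact_of_degreewise_shortExact _ fun n => ?_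
  refine ModuleCat.shortComplex_shortExact _ ?_ ?_ ?_
  · intro x
    constructor
    · intro hx
      exact ⟨⟨x.1, (Submodule.Quotient.mk_eq_zero
        ((torsion P (K.X n)).submoduleOf (torsion Q (K.X n)))).1 hx⟩, rfl⟩
    · rintro ⟨y, rfl⟩
      exact (Submodule.Quotient.mk_eq_zero _).2 y.2
  · exact Submodule.inclusion_injective (torsion_mono h (K.X n))
  · exact Submodule.mkQ_surjective _

end Torsion

/-! ### Filtrations by localizing subcategories -/

variable (A) in
/-- An increasing filtration `⋯ ⊆ M_{q-1} ⊆ M_q ⊆ M_{q+1} ⊆ ⋯` of `Mod A` by localizing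
subcategories, indexed by `ℤ`. -/
structure LocalizingFiltration where
  /-- The localizing subcategory `M_q`. -/
  level (q : ℤ) : ObjectProperty (ModuleCat.{u} A)
  isLocalizing (q : ℤ) : IsLocalizing (level q)
  monotone : Monotone level

namespace LocalizingFiltration

variable (F : LocalizingFiltration A)

/-- The filtration is bounded if `M_{q₀ - 1} = 0` and `M_{q₁} = Mod A` for some `q₀ ≤ q₁`. -/
def IsBounded : Prop :=
  ∃ q₀ q₁ : ℤ, q₀ ≤ q₁ ∧ (∀ M : ModuleCat.{u} A, F.level (q₀ - 1) M → IsZero M) ∧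
    ∀ M : ModuleCat.{u} A, F.level q₁ M

/-- The decreasing indexing `M^p := M_{-p}`. -/
def colevel (p : ℤ) : ObjectProperty (ModuleCat.{u} A) := F.level (-p)

instance (p : ℤ) : IsLocalizing (F.colevel p) := F.isLocalizing (-p)

lemma colevel_antitone : Antitone F.colevel := fun _ _ h => F.monotone (neg_le_neg h)

lemma colevel_succ_le (p : ℤ) : F.colevel (p + 1) ≤ F.colevel p :=
  F.colevel_antitone (by lia)

/-- The functor `Γ_{M^p / M^{p'}} = Γ_{M^p} / Γ_{M^{p'}}`, for `p ≤ p'`. -/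
abbrev quotientTorsion (p p' : ℤ) : ModuleCat.{u} A ⥤ ModuleCat.{u} A :=
  torsionQuotient (F.colevel p') (F.colevel p)

section CousinOfComplex

variable (K : CochainComplex (ModuleCat.{u} A) ℤ)

/-- The subcomplex `Γ_{M^p} K`. -/
abbrev torsionComplex (p : ℤ) : CochainComplex (ModuleCat.{u} A) ℤ :=
  ((torsionFunctor (F.colevel p)).mapHomologicalComplex (.up ℤ)).obj K

/-- The graded piece `Γ_{M^p} K / Γ_{M^{p+1}} K`. -/
abbrev gradedComplex (p : ℤ) : CochainComplex (ModuleCat.{u} A) ℤ :=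
  ((F.quotientTorsion p (p + 1)).mapHomologicalComplex (.up ℤ)).obj K

/-- The map `H^p(Γ_{M^p} K) ⟶ H^p(Γ_{M^p} K / Γ_{M^{p+1}} K)` induced by the projection. -/
def rowProjection (p : ℤ) :
    (F.torsionComplex K p).homology p ⟶ (F.gradedComplex K p).homology p :=
  HomologicalComplex.homologyMap ((NatTrans.mapHomologicalComplex
    (torsionProjection (F.colevel (p + 1)) (F.colevel p)) _).app K) p

/-- The connecting homomorphism
`H^p(Γ_{M^p} K / Γ_{M^{p+1}} K) ⟶ H^{p+1}(Γ_{M^{p+1}} K)`. -/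
def rowConnecting (p : ℤ) :
    (F.gradedComplex K p).homology p ⟶ (F.torsionComplex K (p + 1)).homology (p + 1) :=
  (torsionSequence_shortExact (F.colevel_succ_le p) K).δ p (p + 1) rfl

lemma rowProjection_rowConnecting (p : ℤ) :
    F.rowProjection K p ≫ F.rowConnecting K p = 0 :=
  (torsionSequence_shortExact (F.colevel_succ_le p) K).comp_δ p (p + 1) rfl

/-- The boundary `d_1 : E_1^{p,0} ⟶ E_1^{p+1,0}` on the first page of the spectral sequence
of the filtered complex `{Γ_{M^p} K}`. -/
def rowDifferential (p : ℤ) :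
    (F.gradedComplex K p).homology p ⟶ (F.gradedComplex K (p + 1)).homology (p + 1) :=
  F.rowConnecting K p ≫ F.rowProjection K (p + 1)

lemma rowDifferential_comp (p : ℤ) :
    F.rowDifferential K p ≫ F.rowDifferential K (p + 1) = 0 := by
  rw [rowDifferential, rowDifferential, Category.assoc,
    ← Category.assoc (F.rowProjection K (p + 1)), rowProjection_rowConnecting, zero_comp,
    comp_zero]

/-- The row `q = 0` of the first page
`E_1^{p,q} = H^{p+q}(Γ_{M^p} K / Γ_{M^{p+1}} K)` of the spectral sequence of the filtered
complex `{Γ_{M^p} K}`. -/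
def row : CochainComplex (ModuleCat.{u} A) ℤ :=
  CochainComplex.of (fun p => (F.gradedComplex K p).homology p)
    (F.rowDifferential K) (F.rowDifferential_comp K)

lemma row_d (p : ℤ) : (F.row K).d p (p + 1) = F.rowDifferential K p :=
  CochainComplex.of_d (fun p => (F.gradedComplex K p).homology p) (F.rowDifferential K) p

variable {K} {L : CochainComplex (ModuleCat.{u} A) ℤ} (φ : K ⟶ L) (p : ℤ)

/-- The map on `H^p(Γ_{M^p} K / Γ_{M^{p+1}} K)` induced by a morphism of complexes. -/
def rowMap : (F.gradedComplex K p).homology p ⟶ (F.gradedComplex L p).homology p :=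
  HomologicalComplex.homologyMap
    (((F.quotientTorsion p (p + 1)).mapHomologicalComplex (.up ℤ)).map φ) p

lemma rowProjection_naturality :
    F.rowProjection K p ≫ F.rowMap φ p = HomologicalComplex.homologyMap
      (((torsionFunctor (F.colevel p)).mapHomologicalComplex (.up ℤ)).map φ) p ≫
        F.rowProjection L p := by
  rw [rowProjection, rowProjection, rowMap, ← HomologicalComplex.homologyMap_comp,
    ← HomologicalComplex.homologyMap_comp, NatTrans.naturality]

lemma rowConnecting_naturality :
    F.rowMap φ p ≫ F.rowConnecting L p =
      F.rowConnecting K p ≫ HomologicalComplex.homologyMap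
        (((torsionFunctor (F.colevel (p + 1))).mapHomologicalComplex (.up ℤ)).map φ) (p + 1) :=
  (HomologicalComplex.HomologySequence.δ_naturality
    ((torsionSequence (F.colevel_succ_le p)).map φ)
    (torsionSequence_shortExact _ K) (torsionSequence_shortExact _ L) p (p + 1) rfl).symm

lemma rowDifferential_naturality :
    F.rowMap φ p ≫ F.rowDifferential L p = F.rowDifferential K p ≫ F.rowMap φ (p + 1) := by
  rw [rowDifferential, rowDifferential, ← Category.assoc, rowConnecting_naturality,
    Category.assoc, Category.assoc, rowProjection_naturality]

end CousinOfComplex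

/-- `F.row` as a functor. -/
def rowFunctor : CochainComplex (ModuleCat.{u} A) ℤ ⥤ CochainComplex (ModuleCat.{u} A) ℤ where
  obj K := F.row K
  map {K L} φ := CochainComplex.ofHom (X := F.row K) (Y := F.row L) (F.rowMap φ) (fun p => by
    rw [row_d, row_d]
    exact F.rowDifferential_naturality φ p)
  map_id K := by
    ext p : 1
    change HomologicalComplex.homologyMap _ p = 𝟙 _
    rw [CategoryTheory.Functor.map_id, HomologicalComplex.homologyMap_id]
  map_comp f g := by
    ext p : 1
    change HomologicalComplex.homologyMap _ p = HomologicalComplex.homologyMap _ p ≫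
      HomologicalComplex.homologyMap _ p
    rw [Functor.map_comp, HomologicalComplex.homologyMap_comp]

/-- Homotopic morphisms of complexes induce the same morphism on the row. -/
lemma rowFunctor_map_eq_of_homotopy {K L : CochainComplex (ModuleCat.{u} A) ℤ} {f g : K ⟶ L}
    (h : Homotopy f g) : F.rowFunctor.map f = F.rowFunctor.map g := by
  ext p : 1
  change HomologicalComplex.homologyMap _ p = HomologicalComplex.homologyMap _ p
  exact ((F.quotientTorsion p (p + 1)).mapHomotopy h).homologyMap_eq p

/-- The functor on the homotopy category induced by `rowFunctor`. -/
def rowHomotopyFunctor :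
    HomotopyCategory (ModuleCat.{u} A) (.up ℤ) ⥤ CochainComplex (ModuleCat.{u} A) ℤ :=
  CategoryTheory.Quotient.lift _ F.rowFunctor
    (fun _ _ _ _ ⟨h⟩ => F.rowFunctor_map_eq_of_homotopy h)

variable [HasDerivedCategory.{w} (ModuleCat.{u} A)]

/-- The cohomology functor
`H^n_{M^p / M^{p'}} = H^n ∘ R Γ_{M^p / M^{p'}} : D⁺(Mod A) ⥤ Mod A`, for `p ≤ p'`. -/
def cohomology (p p' n : ℤ) :
    DerivedCategory.Plus (ModuleCat.{u} A) ⥤ ModuleCat.{u} A :=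
  (F.quotientTorsion p p').rightDerivedFunctorPlus ⋙ DerivedCategory.Plus.homologyFunctor _ n

/-- The Cousin functor `E_M : D⁺(Mod A) ⥤ C(Mod A)`, sending `M` to the row `q = 0` of the first
page of the spectral sequence of the filtered complex `{Γ_{M^p} I}`, where `M ⟶ I` is an injective
resolution. It is the right derived functor of the functor sending a complex `K` to the
row `q = 0` of the first page of the spectral sequence of `{Γ_{M^p} K}`. -/
def cousin : DerivedCategory.Plus (ModuleCat.{u} A) ⥤ CochainComplex (ModuleCat.{u} A) ℤ :=
  (HomotopyCategory.Plus.ι _ ⋙ F.rowHomotopyFunctor).totalRightDerived DerivedCategory.Plus.Qh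
    (HomotopyCategory.Plus.quasiIso _)

/-- The natural transformation that is part of the data of the right derived functor `F.cousin`. -/
def cousinUnit :
    HomotopyCategory.Plus.ι _ ⋙ F.rowHomotopyFunctor ⟶ DerivedCategory.Plus.Qh ⋙ F.cousin :=
  (HomotopyCategory.Plus.ι _ ⋙ F.rowHomotopyFunctor).totalRightDerivedUnit
    DerivedCategory.Plus.Qh (HomotopyCategory.Plus.quasiIso _)

instance : F.cousin.IsRightDerivedFunctor F.cousinUnit (HomotopyCategory.Plus.quasiIso _) := by
  dsimp only [cousin, cousinUnit]
  infer_instance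

/-- On a bounded below complex `I` of injective modules, the Cousin complex is the row `q = 0`
of the first page of the spectral sequence of `{Γ_{M^p} I}`. -/
def cousinObjIso (I : CochainComplex.Plus (ModuleCat.{u} A)) [∀ n, Injective (I.obj.X n)] :
    F.row I.obj ≅ F.cousin.obj (DerivedCategory.Plus.Q.obj I) :=
  have (n : ℤ) : Injective (((HomotopyCategory.Plus.quotient _).obj I).obj.as.X n) :=
    inferInstanceAs (Injective (I.obj.X n))
  have : IsIso (F.cousinUnit.app ((HomotopyCategory.Plus.quotient _).obj I)) := inferInstance
  @asIso _ _ _ _ (F.cousinUnit.app ((HomotopyCategory.Plus.quotient _).obj I)) this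

end LocalizingFiltration

end Cousin

/-!
The elements `x` of `Γ_{M^n} I^n` with `d x ∈ Γ_{M^{n+1}} I^{n+1}` form a subcomplex `C` of `I`,
the diagonal of the filtration, and sending `x` to its class in `H^n(Γ_{M^n} I / Γ_{M^{n+1}} I)`
is a surjective morphism from `C` to the Cousin complex. Vanishing of `E_1` above the row `q = 0`
lets one push a cochain with sufficiently deep differential down the filtration, modulo
coboundaries, until it lies in `C`, so `C ⟶ I` is a quasi-isomorphism. Vanishing of `E_1` below
that row gives `H^n(Γ_{M^p} I) = 0` for `n < p`, so the surjection from `C` to the Cousin complex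
has acyclic kernel.
-/

namespace Cousin

section ModuleComplex

universe v

variable {R : Type*} [Ring R] {K L : CochainComplex (ModuleCat.{v} R) ℤ}

lemma d_d_apply (i j k : ℤ) (x : K.X i) : K.d j k (K.d i j x) = 0 :=
  ConcreteCategory.congr_hom (K.d_comp_d i j k) x

lemma hom_d_apply (f : K ⟶ L) (i j : ℤ) (x : K.X i) :
    f.f j (K.d i j x) = L.d i j (f.f i x) :=
  (ConcreteCategory.congr_hom (f.comm i j) x).symm

lemma iCycles_injective (n : ℤ) : Function.Injective (K.iCycles n) :=
  (ModuleCat.mono_iff_injective _).1 inferInstance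

variable (K) in
/-- The identification of the cocycles of degree `n`, as a submodule of `K.X n`, with the abstract
cycles `K.cycles n`. -/
def kerToCycles (n : ℤ) : ModuleCat.of R (LinearMap.ker (K.d n (n + 1)).hom) ⟶ K.cycles n :=
  K.liftCycles (ModuleCat.ofHom (Submodule.subtype _)) (n + 1)
    ((ComplexShape.up ℤ).next_eq' rfl) (by ext x; exact x.2)

lemma iCycles_kerToCycles {n : ℤ} (x : LinearMap.ker (K.d n (n + 1)).hom) :
    K.iCycles n (kerToCycles K n x) = x :=
  ConcreteCategory.congr_hom (K.liftCycles_i (ModuleCat.ofHom (LinearMap.ker _).subtype) _ _ _) x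

lemma cyclesMk_eq_kerToCycles {n : ℤ} (x : LinearMap.ker (K.d n (n + 1)).hom) :
    K.cyclesMk x.1 (n + 1) ((ComplexShape.up ℤ).next_eq' rfl) x.2 = kerToCycles K n x :=
  iCycles_injective n ((K.i_cyclesMk _ _ _ _).trans (iCycles_kerToCycles x).symm)

lemma kerToCycles_surjective (n : ℤ) : Function.Surjective (kerToCycles K n) := fun z =>
  ⟨⟨K.iCycles n z, ConcreteCategory.congr_hom (K.iCycles_d n (n + 1)) z⟩,
    iCycles_injective n (iCycles_kerToCycles _)⟩

variable (K) in
/-- The cohomology class of a cocycle of degree `n` in a complex of modules. -/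
def homologyClass (n : ℤ) : LinearMap.ker (K.d n (n + 1)).hom →ₗ[R] K.homology n :=
  (kerToCycles K n ≫ K.homologyπ n).hom

lemma homologyClass_surjective (n : ℤ) : Function.Surjective (homologyClass K n) :=
  ((ModuleCat.epi_iff_surjective (K.homologyπ n)).1 inferInstance).comp (kerToCycles_surjective n)

lemma homologyClass_eq_zero_iff {n : ℤ} (x : LinearMap.ker (K.d n (n + 1)).hom) :
    homologyClass K n x = 0 ↔ ∃ y : K.X (n - 1), K.d (n - 1) n y = x := by
  have hexact : (ShortComplex.mk _ _ (K.toCycles_comp_homologyπ (n - 1) n)).Exact :=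
    ShortComplex.exact_of_g_is_cokernel _
      (K.homologyIsCokernel (n - 1) n ((ComplexShape.up ℤ).prev_eq' (sub_add_cancel n 1)))
  have hi (y : K.X (n - 1)) : K.iCycles n (K.toCycles (n - 1) n y) = K.d (n - 1) n y :=
    ConcreteCategory.congr_hom (K.toCycles_i (n - 1) n) y
  refine ((ShortComplex.ShortExact.moduleCat_exact_iff_function_exact _).1 hexact
    (kerToCycles K n x)).trans (exists_congr fun y => ?_)
  rw [← (iCycles_injective n).eq_iff, iCycles_kerToCycles, ← hi]

lemma exists_d_eq_of_isZero_homology {n : ℤ} (h : IsZero (K.homology n)) {x : K.X n}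
    (hx : K.d n (n + 1) x = 0) : ∃ y : K.X (n - 1), K.d (n - 1) n y = x :=
  have := ModuleCat.subsingleton_of_isZero h
  (homologyClass_eq_zero_iff ⟨x, hx⟩).1 (Subsingleton.elim _ _)

lemma homologyMap_homologyClass (f : K ⟶ L) {n : ℤ} {x : LinearMap.ker (K.d n (n + 1)).hom}
    {y : LinearMap.ker (L.d n (n + 1)).hom} (hxy : f.f n x = y) :
    HomologicalComplex.homologyMap f n (homologyClass K n x) = homologyClass L n y := by
  have hcycles : HomologicalComplex.cyclesMap f n (kerToCycles K n x) = kerToCycles L n y := by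
    apply iCycles_injective
    rw [iCycles_kerToCycles, ← hxy, ← iCycles_kerToCycles x]
    exact ConcreteCategory.congr_hom (HomologicalComplex.cyclesMap_i f n) _
  exact (ConcreteCategory.congr_hom (HomologicalComplex.homologyπ_naturality f n) _).trans
    (congrArg (L.homologyπ n) hcycles)

lemma δ_homologyClass {S : ShortComplex (CochainComplex (ModuleCat.{v} R) ℤ)}
    (hS : S.ShortExact) {n : ℤ} {x₃ : LinearMap.ker (S.X₃.d n (n + 1)).hom} {x₂ : S.X₂.X n}
    {x₁ : LinearMap.ker (S.X₁.d (n + 1) (n + 1 + 1)).hom} (h₂₃ : S.g.f n x₂ = x₃)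
    (h₁₂ : S.f.f (n + 1) x₁ = S.X₂.d n (n + 1) x₂) :
    hS.δ n (n + 1) rfl (homologyClass S.X₃ n x₃) = homologyClass S.X₁ (n + 1) x₁ := by
  have hδ := hS.δ_apply n (n + 1) rfl x₃.1 x₃.2 x₂ h₂₃ x₁.1 h₁₂ (n + 1 + 1)
    ((ComplexShape.up ℤ).next_eq' rfl)
  exact (congrArg (fun z => hS.δ n (n + 1) rfl (S.X₃.homologyπ n z))
    (cyclesMk_eq_kerToCycles x₃)).symm.trans
      (hδ.trans (congrArg (S.X₁.homologyπ (n + 1)) (cyclesMk_eq_kerToCycles x₁)))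

/-- The hypothesis is the exactness of the mapping cone of `f`, expressed with elements. -/
lemma quasiIso_of_exists_lift (f : K ⟶ L)
    (h : ∀ i j : ℤ, i + 1 = j → ∀ (x : K.X j) (y : L.X i), K.d j (j + 1) x = 0 →
      L.d i j y = f.f j x →
        ∃ w : K.X i, K.d i j w = x ∧ ∃ v : L.X (i - 1), L.d (i - 1) i v = y - f.f i w) :
    QuasiIso f := by
  refine ⟨fun n => (quasiIsoAt_iff_isIso_homologyMap _ _).2
    ((ConcreteCategory.isIso_iff_bijective _).2 ⟨?_, fun b => ?_⟩)⟩
  · refine (injective_iff_map_eq_zero _).2 fun a ha => ?_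
    obtain ⟨x, rfl⟩ := homologyClass_surjective n a
    have hfx : L.d n (n + 1) (f.f n x) = 0 := by
      rw [← hom_d_apply, LinearMap.mem_ker.1 x.2, map_zero]
    rw [homologyMap_homologyClass f (y := ⟨f.f n x, hfx⟩) rfl, homologyClass_eq_zero_iff] at ha
    obtain ⟨y, hy⟩ := ha
    obtain ⟨w, hw, -⟩ := h (n - 1) n (sub_add_cancel n 1) x y x.2 hy
    exact (homologyClass_eq_zero_iff x).2 ⟨w, hw⟩
  · obtain ⟨z, rfl⟩ := homologyClass_surjective n b
    obtain ⟨w, hw, v, hv⟩ := h n (n + 1) rfl 0 z (map_zero _) (by rw [map_zero]; exact z.2)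
    have hfw : L.d n (n + 1) (f.f n w) = 0 := by
      rw [← hom_d_apply, hw, map_zero]
    refine ⟨homologyClass K n ⟨w, hw⟩, ?_⟩
    rw [homologyMap_homologyClass f (y := ⟨f.f n w, hfw⟩) rfl, eq_comm, ← sub_eq_zero, ← map_sub]
    exact (homologyClass_eq_zero_iff _).2 ⟨v, hv⟩

lemma quasiIso_of_surjective (f : K ⟶ L) (hf : ∀ n, Function.Surjective (f.f n))
    (hker : ∀ i j : ℤ, i + 1 = j → ∀ x : K.X j, K.d j (j + 1) x = 0 → f.f j x = 0 →
      ∃ w : K.X i, K.d i j w = x ∧ f.f i w = 0) :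
    QuasiIso f := by
  refine quasiIso_of_exists_lift f fun i j hij x y hdx hy => ?_
  obtain ⟨y, rfl⟩ := hf i y
  obtain ⟨w, hw, hfw⟩ := hker i j hij (x - K.d i j y)
    (by rw [map_sub, hdx, d_d_apply, sub_zero]) (by rw [map_sub, hom_d_apply, hy, sub_self])
  exact ⟨y + w, by rw [map_add, hw, add_sub_cancel], 0,
    by rw [map_add, hfw, add_zero, map_zero, sub_self]⟩

end ModuleComplex

universe v in
/-- A decreasing filtration of a complex of modules by subcomplexes: `sub p n` is the submodule
`F^p K^n` of `K^n`. -/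
structure ComplexFiltration {R : Type*} [Ring R] (K : CochainComplex (ModuleCat.{v} R) ℤ) where
  sub (p n : ℤ) : Submodule R (K.X n)
  antitone (n : ℤ) : Antitone fun p => sub p n
  le_comap_d (p i j : ℤ) : sub p i ≤ (sub p j).comap (K.d i j).hom

namespace ComplexFiltration

universe v

variable {R : Type*} [Ring R] {K : CochainComplex (ModuleCat.{v} R) ℤ} (S : ComplexFiltration K)

/-- The vanishing of `H^n(F^p K / F^{p+1} K)`, in terms of representatives in `K`. -/
def IsGradedExactAt (p n : ℤ) : Prop :=
  ∀ x ∈ S.sub p n, K.d n (n + 1) x ∈ S.sub (p + 1) (n + 1) →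
    ∃ y ∈ S.sub p (n - 1), x - K.d (n - 1) n y ∈ S.sub (p + 1) n

variable {S}

lemma exists_sub_d_mem {p p' n : ℤ} (hpp' : p ≤ p')
    (h : ∀ s, p ≤ s → s < p' → S.IsGradedExactAt s n) {x : K.X n} (hx : x ∈ S.sub p n)
    (hdx : K.d n (n + 1) x ∈ S.sub p' (n + 1)) :
    ∃ y ∈ S.sub p (n - 1), x - K.d (n - 1) n y ∈ S.sub p' n := by
  induction p', hpp' using Int.leInduction with
  | base => exact ⟨0, zero_mem _, by rwa [map_zero, sub_zero]⟩
  | succ r hr ih =>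
    obtain ⟨y, hy, hxy⟩ := ih (fun s hs hsr => h s hs (by lia)) (S.antitone _ (by lia) hdx)
    obtain ⟨z, hz, hxz⟩ := h r hr (by lia) _ hxy (by rwa [map_sub, d_d_apply, sub_zero])
    exact ⟨y + z, add_mem hy (S.antitone _ hr hz), by rwa [map_add, ← sub_sub]⟩

/-- This says that `H^n(K / F^p K) = 0`. -/
lemma exists_sub_d_mem_of_exhaustive {p n : ℤ} (hexhaustive : ∀ x : K.X n, ∃ s, x ∈ S.sub s n)
    (h : ∀ s < p, S.IsGradedExactAt s n) {x : K.X n}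
    (hdx : K.d n (n + 1) x ∈ S.sub p (n + 1)) :
    ∃ y : K.X (n - 1), x - K.d (n - 1) n y ∈ S.sub p n := by
  obtain ⟨s, hs⟩ := hexhaustive x
  obtain ⟨y, -, hy⟩ := exists_sub_d_mem (min_le_right s p) (fun r _ hr => h r hr)
    (S.antitone _ (min_le_left s p) hs) hdx
  exact ⟨y, hy⟩

/-- This says that `H^n(F^p K) = 0`. -/
lemma exists_mem_d_eq {p q n : ℤ} (hq : S.sub q n = ⊥)
    (h : ∀ s, p ≤ s → S.IsGradedExactAt s n) {x : K.X n} (hx : x ∈ S.sub p n)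
    (hdx : K.d n (n + 1) x = 0) : ∃ y ∈ S.sub p (n - 1), K.d (n - 1) n y = x := by
  obtain ⟨y, hy, hxy⟩ := exists_sub_d_mem (le_max_left p q) (fun s hs _ => h s hs) hx
    (by rw [hdx]; exact zero_mem _)
  have hbot : x - K.d (n - 1) n y ∈ S.sub q n := S.antitone n (le_max_right p q) hxy
  rw [hq, Submodule.mem_bot, sub_eq_zero] at hbot
  exact ⟨y, hy, hbot.symm⟩

variable (S)

/-- The submodule of `x ∈ F^n K^n` such that `d x ∈ F^{n+1} K^{n+1}`: the diagonal cochains, those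
which represent elements of the row `q = 0` of `E_1`. -/
def diagonal (n : ℤ) : Submodule R (K.X n) :=
  S.sub n n ⊓ (S.sub (n + 1) (n + 1)).comap (K.d n (n + 1)).hom

variable {S} in
lemma mem_diagonal {m n : ℤ} (hmn : m + 1 = n) {x : K.X m} (hx : x ∈ S.sub m m)
    (hdx : K.d m n x ∈ S.sub n n) : x ∈ S.diagonal m := by
  subst hmn
  exact ⟨hx, hdx⟩

lemma diagonal_le_comap_d (i j : ℤ) : S.diagonal i ≤ (S.diagonal j).comap (K.d i j).hom := by
  intro x hx
  by_cases hij : i + 1 = j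
  · subst hij
    have hddx : K.d (i + 1) (i + 1 + 1) (K.d i (i + 1) x) ∈ S.sub (i + 1 + 1) (i + 1 + 1) := by
      rw [d_d_apply]
      exact zero_mem _
    exact ⟨hx.2, hddx⟩
  · rw [K.shape i j hij]
    exact zero_mem (S.diagonal j)

/-- The subcomplex of `K` of diagonal cochains. -/
def diagonalComplex : CochainComplex (ModuleCat.{v} R) ℤ where
  X n := ModuleCat.of R (S.diagonal n)
  d i j := ModuleCat.ofHom ((K.d i j).hom.restrict (S.diagonal_le_comap_d i j))
  shape i j hij := by
    ext x
    exact ConcreteCategory.congr_hom (K.shape i j hij) x.1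
  d_comp_d' i j k _ _ := by
    ext x
    exact d_d_apply i j k x.1

/-- The inclusion of the subcomplex of diagonal cochains. -/
def diagonalInclusion : S.diagonalComplex ⟶ K where
  f n := ModuleCat.ofHom (Submodule.subtype _)

variable {S}

lemma quasiIso_diagonalInclusion (hexhaustive : ∀ (n : ℤ) (x : K.X n), ∃ p, x ∈ S.sub p n)
    (h : ∀ p n : ℤ, p < n → S.IsGradedExactAt p n) : QuasiIso S.diagonalInclusion := by
  refine quasiIso_of_exists_lift _ ?_
  rintro i _ rfl ⟨x, hx⟩ y - (hy : K.d i (i + 1) y = x)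
  obtain ⟨v, hv⟩ := exists_sub_d_mem_of_exhaustive (hexhaustive i) (fun s hs => h s i hs)
    (x := y) (by rw [hy]; exact S.antitone _ (by lia) hx.1)
  have hd : K.d i (i + 1) (y - K.d (i - 1) i v) = x := by
    rw [map_sub, hy, d_d_apply, sub_zero]
  have hmem : K.d i (i + 1) (y - K.d (i - 1) i v) ∈ S.sub (i + 1) (i + 1) := by
    rw [hd]
    exact hx.1
  exact ⟨⟨_, hv, hmem⟩, Subtype.ext hd, v, (sub_sub_cancel y _).symm⟩

end ComplexFiltration

namespace LocalizingFiltration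

section Complex

variable {A : Type u} [Ring A] (F : LocalizingFiltration A)

variable {F} in
lemma IsBounded.exists_torsion_colevel_eq_top (hF : F.IsBounded) :
    ∃ p : ℤ, ∀ M : ModuleCat.{u} A, torsion (F.colevel p) M = ⊤ := by
  obtain ⟨_, q₁, -, -, h⟩ := hF
  refine ⟨-q₁, fun M => eq_top_iff.2 fun x _ => ?_⟩
  exact F.monotone (neg_neg q₁).ge _ (h _)

variable {F} in
lemma IsBounded.exists_torsion_colevel_eq_bot (hF : F.IsBounded) :
    ∃ p : ℤ, ∀ M : ModuleCat.{u} A, torsion (F.colevel p) M = ⊥ := by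
  obtain ⟨q₀, _, -, h, -⟩ := hF
  refine ⟨-(q₀ - 1), fun M => eq_bot_iff.2 fun x hx => ?_⟩
  have := ModuleCat.subsingleton_of_isZero
    (h _ (F.monotone (neg_neg (q₀ - 1)).le _ ((mem_torsion_iff (F.colevel _) x).1 hx)))
  exact Submodule.span_singleton_eq_bot.1 ((Submodule.subsingleton_iff_eq_bot).1 this)

variable (K : CochainComplex (ModuleCat.{u} A) ℤ)

/-- The filtration of a complex `K` by the subcomplexes `Γ_{M^p} K`. -/
def torsionFiltration : ComplexFiltration K where
  sub p n := torsion (F.colevel p) (K.X n)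
  antitone n _ _ h := torsion_mono (F.colevel_antitone h) (K.X n)
  le_comap_d p i j := torsion_le_comap (F.colevel p) (K.d i j)

lemma gradedComplex_d_mk_eq_mk_iff {p i j : ℤ} (y : torsion (F.colevel p) (K.X i))
    (x : torsion (F.colevel p) (K.X j)) :
    (F.gradedComplex K p).d i j (Submodule.Quotient.mk y) = Submodule.Quotient.mk x ↔
      (x - K.d i j y : K.X j) ∈ torsion (F.colevel (p + 1)) (K.X j) :=
  eq_comm.trans (Submodule.Quotient.eq
    ((torsion (F.colevel (p + 1)) (K.X j)).submoduleOf (torsion (F.colevel p) (K.X j)))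
    (x := x) (y := ⟨K.d i j y, torsion_le_comap (F.colevel p) (K.d i j) y.2⟩))

variable {F K} in
lemma isGradedExactAt_of_isZero {p n : ℤ} (h : IsZero ((F.gradedComplex K p).homology n)) :
    (F.torsionFiltration K).IsGradedExactAt p n := by
  intro x hx hdx
  obtain ⟨y, hy⟩ := exists_d_eq_of_isZero_homology h (x := Submodule.Quotient.mk ⟨x, hx⟩)
    ((Submodule.Quotient.mk_eq_zero _).2 hdx)
  obtain ⟨y, rfl⟩ := Submodule.Quotient.mk_surjective _ y
  exact ⟨y, y.2, (F.gradedComplex_d_mk_eq_mk_iff K y ⟨x, hx⟩).1 hy⟩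

/-- The cocycle of `Γ_{M^n} K / Γ_{M^{n+1}} K` represented by a diagonal cochain. -/
def diagonalToGraded (n : ℤ) : (F.torsionFiltration K).diagonal n →ₗ[A]
    LinearMap.ker ((F.gradedComplex K n).d n (n + 1)).hom :=
  (((torsionProjection (F.colevel (n + 1)) (F.colevel n)).app (K.X n)).hom ∘ₗ
    (Submodule.inclusion inf_le_left :
      (F.torsionFiltration K).diagonal n →ₗ[A] torsion (F.colevel n) (K.X n))).codRestrict _
    fun x => (Submodule.Quotient.mk_eq_zero _).2 x.2.2

lemma diagonalToGraded_surjective (n : ℤ) : Function.Surjective (F.diagonalToGraded K n) := by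
  rintro ⟨z, hz⟩
  obtain ⟨x, rfl⟩ := Submodule.Quotient.mk_surjective _ z
  have hdx := (Submodule.Quotient.mk_eq_zero ((torsion (F.colevel (n + 1))
    (K.X (n + 1))).submoduleOf (torsion (F.colevel n) (K.X (n + 1))))).1 hz
  exact ⟨⟨x, x.2, hdx⟩, rfl⟩

lemma rowDifferential_homologyClass {n : ℤ} (x : (F.torsionFiltration K).diagonal n) :
    F.rowDifferential K n (homologyClass _ n (F.diagonalToGraded K n x)) =
      homologyClass _ (n + 1) (F.diagonalToGraded K (n + 1)
        ((F.torsionFiltration K).diagonalComplex.d n (n + 1) x)) := by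
  let dx : LinearMap.ker ((F.torsionComplex K (n + 1)).d (n + 1) (n + 1 + 1)).hom :=
    ⟨⟨K.d n (n + 1) x, x.2.2⟩, Subtype.ext (d_d_apply n (n + 1) (n + 1 + 1) x.1)⟩
  have hconnecting : F.rowConnecting K n (homologyClass _ n (F.diagonalToGraded K n x)) =
      homologyClass _ (n + 1) dx :=
    δ_homologyClass (torsionSequence_shortExact (F.colevel_succ_le n) K)
      (x₂ := (⟨x, x.2.1⟩ : torsion (F.colevel n) (K.X n))) rfl rfl
  exact (congrArg (F.rowProjection K (n + 1)) hconnecting).trans (homologyMap_homologyClass _ rfl)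

/-- The morphism from the diagonal of the filtration `{Γ_{M^p} K}` to the row `q = 0` of `E_1`,
sending a cochain to the cohomology class that it represents. -/
def diagonalToRow : (F.torsionFiltration K).diagonalComplex ⟶ F.row K where
  f n := ModuleCat.ofHom (homologyClass (F.gradedComplex K n) n ∘ₗ F.diagonalToGraded K n)
  comm' n _ hn := by
    obtain rfl := hn
    rw [row_d]
    ext x
    exact F.rowDifferential_homologyClass K x

lemma diagonalToRow_f_surjective (n : ℤ) : Function.Surjective ((F.diagonalToRow K).f n) :=
  (homologyClass_surjective n).comp (F.diagonalToGraded_surjective K n)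

lemma diagonalToRow_f_eq_zero_iff {n : ℤ} (x : (F.torsionFiltration K).diagonal n) :
    (F.diagonalToRow K).f n x = 0 ↔ ∃ y : torsion (F.colevel n) (K.X (n - 1)),
      (x - K.d (n - 1) n y : K.X n) ∈ torsion (F.colevel (n + 1)) (K.X n) := by
  refine (homologyClass_eq_zero_iff (F.diagonalToGraded K n x)).trans
    ((Submodule.Quotient.mk_surjective _).exists.trans ?_)
  exact exists_congr fun y => F.gradedComplex_d_mk_eq_mk_iff K y ⟨x.1, x.2.1⟩

variable {F K}

lemma quasiIso_diagonalToRow (hbot : ∀ n : ℤ, ∃ p, torsion (F.colevel p) (K.X n) = ⊥)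
    (h : ∀ p n : ℤ, n < p → IsZero ((F.gradedComplex K p).homology n)) :
    QuasiIso (F.diagonalToRow K) := by
  refine quasiIso_of_surjective _ (F.diagonalToRow_f_surjective K) ?_
  rintro i n hin x hdx hx
  obtain rfl : i = n - 1 := by lia
  replace hdx : K.d n (n + 1) x.1 = 0 := congrArg Subtype.val hdx
  obtain ⟨y, hxy⟩ := (F.diagonalToRow_f_eq_zero_iff K x).1 hx
  obtain ⟨p, hp⟩ := hbot n
  obtain ⟨z, hz, hdz⟩ := ComplexFiltration.exists_mem_d_eq (S := F.torsionFiltration K) hp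
    (fun s hs => isGradedExactAt_of_isZero (h s n hs)) hxy
    (by rw [map_sub, hdx, d_d_apply, sub_zero])
  have hd : K.d (n - 1) n (y + z) = x.1 := by
    rw [map_add, hdz, add_sub_cancel]
  have hyz : y + z ∈ torsion (F.colevel n) (K.X (n - 1)) :=
    add_mem y.2 ((F.torsionFiltration K).antitone _ (by lia) hz)
  have hmem : y + z ∈ (F.torsionFiltration K).diagonal (n - 1) :=
    ComplexFiltration.mem_diagonal hin ((F.torsionFiltration K).antitone _ (by lia) hyz)
      (hd ▸ x.2.1)
  refine ⟨⟨_, hmem⟩, Subtype.ext hd, (F.diagonalToRow_f_eq_zero_iff K ⟨_, hmem⟩).2 ⟨0, ?_⟩⟩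
  rw [ZeroMemClass.coe_zero, map_zero, sub_zero, sub_add_cancel]
  exact hyz

lemma nonempty_iso_Q_obj_row [HasDerivedCategory.{w} (ModuleCat.{u} A)] (hF : F.IsBounded)
    (K : CochainComplex (ModuleCat.{u} A) ℤ)
    (h : ∀ p n : ℤ, n ≠ p → IsZero ((F.gradedComplex K p).homology n)) :
    Nonempty (DerivedCategory.Q.obj K ≅ DerivedCategory.Q.obj (F.row K)) := by
  obtain ⟨p, hp⟩ := hF.exists_torsion_colevel_eq_top
  obtain ⟨q, hq⟩ := hF.exists_torsion_colevel_eq_bot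
  have hinclusion : QuasiIso (F.torsionFiltration K).diagonalInclusion :=
    ComplexFiltration.quasiIso_diagonalInclusion
      (fun n x => ⟨p, Submodule.eq_top_iff'.1 (hp (K.X n)) x⟩)
      (fun p n hpn => isGradedExactAt_of_isZero (h p n hpn.ne'))
  have hrow : QuasiIso (F.diagonalToRow K) :=
    quasiIso_diagonalToRow (fun n => ⟨q, hq (K.X n)⟩) (fun p n hnp => h p n hnp.ne)
  exact ⟨(asIso (DerivedCategory.Q.map (F.torsionFiltration K).diagonalInclusion)).symm ≪≫
    asIso (DerivedCategory.Q.map (F.diagonalToRow K))⟩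

end Complex

end LocalizingFiltration

section RightDerived

universe v v' u' u'' w'

variable {C : Type u'} [Category.{v} C] [Abelian C] [HasDerivedCategory.{w} C]
  [EnoughInjectives C] {D : Type u''} [Category.{v'} D] [Abelian D] [HasDerivedCategory.{w'} D]

/-- The cohomology of the right derived functor of `G` at a bounded below complex `I` of injective
objects is the cohomology of `G I`. -/
def rightDerivedHomologyIso (G : C ⥤ D) [G.Additive] (n : ℤ) (I : CochainComplex.Plus C)
    [∀ n, Injective (I.obj.X n)] :
    (DerivedCategory.Plus.homologyFunctor D n).obj
        (G.rightDerivedFunctorPlus.obj (DerivedCategory.Plus.Q.obj I)) ≅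
      ((G.mapHomologicalComplex (.up ℤ)).obj I.obj).homology n :=
  have (n : ℤ) : Injective (((HomotopyCategory.Plus.quotient C).obj I).obj.as.X n) :=
    inferInstanceAs (Injective (I.obj.X n))
  have : IsIso (G.rightDerivedFunctorPlusUnit.app
    ((HomotopyCategory.Plus.quotient C).obj I)) := inferInstance
  (DerivedCategory.Plus.homologyFunctor D n).mapIso
      (@asIso _ _ _ _ (G.rightDerivedFunctorPlusUnit.app
        ((HomotopyCategory.Plus.quotient C).obj I)) this).symm ≪≫
    (DerivedCategory.homologyFunctor D n).mapIso
      ((DerivedCategory.quotientCompQhIso D).app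
        ((G.mapHomologicalComplex (.up ℤ)).obj I.obj)) ≪≫
    (DerivedCategory.homologyFunctorFactors D n).app _

lemma exists_injective_nonempty_Q_obj_iso (M : DerivedCategory.Plus C) :
    ∃ I : CochainComplex.Plus C, (∀ n, Injective (I.obj.X n)) ∧
      Nonempty (DerivedCategory.Plus.Q.obj I ≅ M) := by
  obtain ⟨n, hn⟩ := M.property
  have : M.IsGE n := ⟨hn.ge⟩
  obtain ⟨I, -, e⟩ := DerivedCategory.Plus.exists_injective_nonempty_iso M n
  exact ⟨(InjectiveObject.ι C).mapCochainComplexPlus.obj I, fun n => (I.obj.X n).property, e⟩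

end RightDerived

end Cousin

theorem theorem2p1_general {A : Type u} [Ring A] [HasDerivedCategory.{w} (ModuleCat.{u} A)]
    (F : Cousin.LocalizingFiltration A) (hF : F.IsBounded)
    (M : DerivedCategory.Plus (ModuleCat.{u} A))
    (hCM : ∀ p q : ℤ, q ≠ 0 → IsZero ((F.cohomology p (p + 1) (p + q)).obj M)) :
    Nonempty (M.obj ≅ DerivedCategory.Q.obj (F.cousin.obj M)) := by
  obtain ⟨I, hI, ⟨e⟩⟩ := Cousin.exists_injective_nonempty_Q_obj_iso M
  have hgraded (p n : ℤ) (hnp : n ≠ p) : IsZero ((F.gradedComplex I.obj p).homology n) := by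
    have h := hCM p (n - p) (sub_ne_zero.2 hnp)
    rw [add_sub_cancel] at h
    exact h.of_iso ((Cousin.rightDerivedHomologyIso (F.quotientTorsion p (p + 1)) n I).symm ≪≫
      (F.cohomology p (p + 1) n).mapIso e)
  obtain ⟨e'⟩ := F.nonempty_iso_Q_obj_row hF I.obj hgraded
  exact ⟨DerivedCategory.Plus.ι.mapIso e.symm ≪≫
    (DerivedCategory.quotientCompQhIso _).app I.obj ≪≫ e' ≪≫
    DerivedCategory.Q.mapIso (F.cousinObjIso I ≪≫ F.cousin.mapIso e)⟩

theorem theorem2p1 {A : Type u} [Ring A] [HasDerivedCategory.{w} (ModuleCat.{u} A)]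
    (F : Cousin.LocalizingFiltration A) (hF : F.IsBounded)
    (M : DerivedCategory (ModuleCat.{u} A)) (hM : DerivedCategory.TStructure.t.bounded M)
    (hCM : ∀ p q : ℤ, q ≠ 0 → IsZero ((F.cohomology p (p + 1) (p + q)).obj ⟨M, hM.1⟩)) :
    Nonempty (M ≅ DerivedCategory.Q.obj (F.cousin.obj ⟨M, hM.1⟩)) :=
  theorem2p1_general F hF ⟨M, hM.1⟩ hCM
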